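/- Let $n\ge 1$, let $X_1,\dots,X_n$ and $Y$ be real Banach spaces, and equip $X:=X_1\times\cdots\times X_n$ with the maximum norm. Write $\mathcal L(X_i,Y)$ for the Banach space of continuous linear maps $X_i\to Y$ with the operator norm. Call a map $g:E\to F$ between Banach spaces generically Fréchet differentiable if the set of points of $E$ at which $g$ is not Fréchet differentiable is of the first category (meagre) in $E$. Suppose that $X_i$ is separable for every $1\le i\le n$ and that $\mathcal L(X_i,Y)$ is separable for every $1\le i\le n-1$. Let $f:X\to Y$ be continuous, and suppose that for every $1\le i\le n$ and every choice of $x_j\in X_j$ ($j\ne i$) the partial function $$X_i\to Y,\qquad t\mapsto f(x_1,\dots,x_{i-1},t,x_{i+1},\dots,x_n),$$ is generically Fréchet differentiable. Then $f$ is generically Fréchet differentiable. -/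

import Mathlib

/-- A map between real normed spaces is generically Fréchet differentiable if the set of points
at which it is not Fréchet differentiable is of the first category (meagre). -/
def GenericallyFrechetDifferentiable {E F : Type*} [NormedAddCommGroup E] [NormedSpace ℝ E]
    [NormedAddCommGroup F] [NormedSpace ℝ F] (f : E → F) : Prop :=
  IsMeagre {x : E | ¬ DifferentiableAt ℝ f x}

/-! Induction on the number of variables splits off the first factor, whose operator space is
separable; the tail is handled by the inductive hypothesis. For two variables, `f` is differentiable
wherever both partial derivatives exist and, for each `ε`, a single operator approximates the
first-variable increments up to `ε` on a neighbourhood of the point.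

To make these conditions generic in the product, each is written as a countable intersection of
countable unions of closed sets. If closed sets cover residually many points of every horizontal
section, Kuratowski–Ulam and Baire make the union of their interiors dense, and lying in an interior
supplies the local uniformity.

The closed sets come from a dense sequence of operators in the first variable, and from a
Cauchy-type criterion naming no derivative in the second, where the operator space may be
nonseparable. -/

open Set Filter Topology

/-! ### Category in products -/

section KuratowskiUlam

variable {X Y : Type*} [TopologicalSpace X] [TopologicalSpace Y]

/-- Almost all horizontal sections of a dense open subset of a product are dense. -/
theorem eventually_residual_dense_section [SecondCountableTopology X] {O : Set (X × Y)}
    (ho : IsOpen O) (hd : Dense O) : ∀ᶠ y in residual Y, Dense {x | (x, y) ∈ O} := by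
  have key : ∀ U ∈ TopologicalSpace.countableBasis X,
      ∀ᶠ y in residual Y, ∃ x ∈ U, (x, y) ∈ O := by
    intro U hU
    have hUo : IsOpen U := TopologicalSpace.isOpen_of_mem_countableBasis hU
    have hUne : U.Nonempty := TopologicalSpace.nonempty_of_mem_countableBasis hU
    have himage : {y | ∃ x ∈ U, (x, y) ∈ O} = Prod.snd '' (O ∩ U ×ˢ univ) := by
      ext y
      simp only [mem_ofPred_eq, mem_image, mem_inter_iff, mem_prod, mem_univ, and_true,
        Prod.exists, exists_eq_right]
      exact ⟨fun ⟨x, hx, hxy⟩ => ⟨x, hxy, hx⟩, fun ⟨x, hxy, hx⟩ => ⟨x, hx, hxy⟩⟩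
    refine residual_of_dense_open (s := {y | ∃ x ∈ U, (x, y) ∈ O}) ?_ ?_
    · rw [himage]
      exact isOpenMap_snd _ (ho.inter (hUo.prod isOpen_univ))
    · rw [dense_iff_inter_open]
      intro V hV hVne
      obtain ⟨⟨x, y⟩, ⟨hx, hy⟩, hxy⟩ :=
        dense_iff_inter_open.1 hd (U ×ˢ V) (hUo.prod hV) (hUne.prod hVne)
      exact ⟨y, hy, x, hx, hxy⟩
  have hall := (eventually_countable_ball (TopologicalSpace.countable_countableBasis X)).2 key
  filter_upwards [hall] with y hy
  rw [(TopologicalSpace.isBasis_countableBasis X).dense_iff]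
  intro U hU _
  obtain ⟨x, hx, hxy⟩ := hy U hU
  exact ⟨x, hx, hxy⟩

/-- If all horizontal sections of a countable union of closed sets are residual, then the
interiors of these closed sets have a dense union. -/
theorem dense_iUnion_interior_of_residual_sections [SecondCountableTopology X] [BaireSpace X]
    [BaireSpace Y] {ι : Type*} [Countable ι] {F : ι → Set (X × Y)} (hF : ∀ i, IsClosed (F i))
    (hres : ∀ y, ∀ᶠ x in residual X, ∃ i, (x, y) ∈ F i) : Dense (⋃ i, interior (F i)) := by
  rw [dense_iff_inter_open]
  intro W hW ⟨⟨a, b⟩, hab⟩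
  by_contra hempty
  obtain ⟨U, V, hU, hV, haU, hbV, hUV⟩ := isOpen_prod_iff.1 hW a b hab
  have hdisj : ∀ i, Disjoint (interior (F i)) W := by
    intro i
    rw [Set.disjoint_left]
    intro p hp hpW
    exact hempty ⟨p, hpW, mem_iUnion.2 ⟨i, hp⟩⟩
  -- An open set missing `W` misses `closure W`, so each `F i ∩ closure W` is closed and nowhere
  -- dense.
  have hdense : ∀ i, Dense (F i ∩ closure W)ᶜ := by
    intro i
    rw [← interior_eq_empty_iff_dense_compl, interior_inter, ← disjoint_iff_inter_eq_empty]
    exact ((hdisj i).closure_right isOpen_interior).mono_right interior_subset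
  have hopen : ∀ i, IsOpen (F i ∩ closure W)ᶜ :=
    fun i => ((hF i).inter isClosed_closure).isOpen_compl
  have hgeneric : ∀ᶠ y in residual Y, ∀ i, Dense {x | (x, y) ∈ (F i ∩ closure W)ᶜ} :=
    eventually_countable_forall.2 fun i => eventually_residual_dense_section (hopen i) (hdense i)
  -- On the section at a generic `y ∈ V`, a generic `x ∈ U` lies in some `F i` but in no `F i ∩
  -- closure W`, although `(x, y) ∈ W`.
  obtain ⟨y, hyV, hy⟩ := (dense_of_mem_residual hgeneric).inter_open_nonempty V hV ⟨b, hbV⟩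
  have hsection : ∀ᶠ x in residual X, ∀ i, (x, y) ∈ (F i ∩ closure W)ᶜ :=
    eventually_countable_forall.2 fun i => residual_of_dense_open
      ((hopen i).preimage (Continuous.prodMk_left y)) (hy i)
  obtain ⟨x, hxU, ⟨i, hi⟩, hx⟩ := (dense_of_mem_residual ((hres y).and hsection)).inter_open_nonempty
    U hU ⟨a, haU⟩
  exact hx i ⟨hi, subset_closure (hUV ⟨hxU, hyV⟩)⟩

/-- Pointwise form of `dense_iUnion_interior_of_residual_sections`. -/
theorem eventually_residual_mem_interior [SecondCountableTopology X] [BaireSpace X]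
    [BaireSpace Y] {ι : Type*} [Countable ι] {F : ι → Set (X × Y)} (hF : ∀ i, IsClosed (F i))
    (hres : ∀ y, ∀ᶠ x in residual X, ∃ i, (x, y) ∈ F i) :
    ∀ᶠ p in residual (X × Y), ∃ i, p ∈ interior (F i) := by
  filter_upwards [residual_of_dense_open (isOpen_iUnion fun _ => isOpen_interior)
    (dense_iUnion_interior_of_residual_sections hF hres)] with p hp
  exact mem_iUnion.1 hp

end KuratowskiUlam

/-! ### Differentiability without naming the derivative -/

section Differentiability

variable {E F : Type*} [NormedAddCommGroup E] [NormedSpace ℝ E]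
  [NormedAddCommGroup F] [NormedSpace ℝ F]

/-- The increments of `g` at `y` are homogeneous and additive up to a relative error `ε`
on the ball of radius `δ`. -/
def IncrementsAlmostLinear (g : E → F) (y : E) (ε δ : ℝ) : Prop :=
  (∀ h : E, ‖h‖ ≤ δ → ∀ r ∈ Icc (0 : ℝ) 1,
    ‖g (y + r • h) - g y - r • (g (y + h) - g y)‖ ≤ ε * (r * ‖h‖)) ∧
  ∀ h k : E, ‖h‖ ≤ δ → ‖k‖ ≤ δ →
    ‖g (y + (h + k)) - g y - (g (y + h) - g y) - (g (y + k) - g y)‖ ≤ ε * (‖h‖ + ‖k‖)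

theorem IncrementsAlmostLinear.mono {g : E → F} {y : E} {ε δ δ' : ℝ}
    (hg : IncrementsAlmostLinear g y ε δ) (hδ : δ' ≤ δ) : IncrementsAlmostLinear g y ε δ' :=
  ⟨fun h hh => hg.1 h (hh.trans hδ), fun h k hh hk => hg.2 h k (hh.trans hδ) (hk.trans hδ)⟩

theorem isClosed_setOf_incrementsAlmostLinear {P : Type*} [TopologicalSpace P] {f : P × E → F}
    (hf : Continuous f) (ε δ : ℝ) :
    IsClosed {p : P × E | IncrementsAlmostLinear (fun t => f (p.1, t)) p.2 ε δ} := by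
  simp only [IncrementsAlmostLinear, ofPred_and, ofPred_forall]
  refine IsClosed.inter ?_ ?_
  · refine isClosed_iInter fun h => isClosed_iInter fun _ => isClosed_iInter fun r =>
      isClosed_iInter fun _ => isClosed_le (by fun_prop) continuous_const
  · refine isClosed_iInter fun h => isClosed_iInter fun k => isClosed_iInter fun _ =>
      isClosed_iInter fun _ => isClosed_le (by fun_prop) continuous_const

theorem HasFDerivAt.exists_norm_increment_sub_le {g : E → F} {L : E →L[ℝ] F} {y : E}
    (hL : HasFDerivAt g L y) {ε : ℝ} (hε : 0 < ε) :
    ∃ δ > 0, ∀ h : E, ‖h‖ ≤ δ → ‖g (y + h) - g y - L h‖ ≤ ε * ‖h‖ := by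
  have h1 := (hasFDerivAt_iff_isLittleO_nhds_zero.1 hL).def hε
  obtain ⟨δ, hδ, hball⟩ := Metric.eventually_nhds_iff_ball.1 h1
  refine ⟨δ / 2, half_pos hδ, fun h hh => hball h ?_⟩
  rw [mem_ball_zero_iff]
  linarith

theorem DifferentiableAt.exists_incrementsAlmostLinear {g : E → F} {y : E}
    (hg : DifferentiableAt ℝ g y) {ε : ℝ} (hε : 0 < ε) :
    ∃ δ > 0, IncrementsAlmostLinear g y ε δ := by
  obtain ⟨L, hL⟩ := hg
  obtain ⟨δ, hδ, hb⟩ := hL.exists_norm_increment_sub_le (half_pos hε)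
  -- Halving the radius keeps `h + k` within `δ`; halving `ε` absorbs `‖h + k‖ + ‖h‖ + ‖k‖ ≤ 2 *
  -- (‖h‖ + ‖k‖)`.
  refine ⟨δ / 2, half_pos hδ, fun h hh r hr => ?_, fun h k hh hk => ?_⟩
  · have h1 := hb h (by linarith)
    have hrh : ‖r • h‖ = r * ‖h‖ := by rw [norm_smul, Real.norm_of_nonneg hr.1]
    have h2 := hb (r • h) (by
      rw [hrh]
      nlinarith [hr.1, hr.2, norm_nonneg h])
    have heq : g (y + r • h) - g y - r • (g (y + h) - g y) =
        (g (y + r • h) - g y - L (r • h)) - r • (g (y + h) - g y - L h) := by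
      rw [map_smul]
      module
    have h3 : ‖r • (g (y + h) - g y - L h)‖ ≤ r * (ε / 2 * ‖h‖) := by
      rw [norm_smul, Real.norm_of_nonneg hr.1]
      exact mul_le_mul_of_nonneg_left h1 hr.1
    rw [heq]
    rw [hrh] at h2
    refine (norm_sub_le _ _).trans ?_
    linarith
  · have h1 := hb h (by linarith)
    have h2 := hb k (by linarith)
    have hle := norm_add_le h k
    have h3 := hb (h + k) (by linarith)
    have heq : g (y + (h + k)) - g y - (g (y + h) - g y) - (g (y + k) - g y) =
        (g (y + (h + k)) - g y - L (h + k)) - (g (y + h) - g y - L h) -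
          (g (y + k) - g y - L k) := by
      rw [map_add]
      abel
    rw [heq]
    have h4 := norm_sub_le ((g (y + (h + k)) - g y - L (h + k)) - (g (y + h) - g y - L h))
      (g (y + k) - g y - L k)
    have h5 := norm_sub_le (g (y + (h + k)) - g y - L (h + k)) (g (y + h) - g y - L h)
    nlinarith

/-- A map into a Banach space whose increments at `y` are asymptotically linear
is differentiable at `y`. -/
theorem differentiableAt_of_incrementsAlmostLinear [CompleteSpace F] {g : E → F} {y : E}
    (hc : ContinuousAt g y) (hg : ∀ ε > 0, ∃ δ > 0, IncrementsAlmostLinear g y ε δ) :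
    DifferentiableAt ℝ g y := by
  set G : E → F := fun h => g (y + h) - g y with hG
  -- The derivative at `h` will be the limit of the quotients `(r m)⁻¹ • G (r m • h)`. Ratios of
  -- later to earlier scales are again values of `r` in `[0, 1]`, so near-homogeneity compares the
  -- quotients.
  set r : ℕ → ℝ := fun m => (2⁻¹ : ℝ) ^ m with hr
  have hr0 : ∀ m, 0 < r m := fun m => by positivity
  have hr1 : ∀ m, r m ≤ 1 := fun m => pow_le_one₀ (by norm_num) (by norm_num)
  have hrt : Tendsto r atTop (𝓝 0) :=
    tendsto_pow_atTop_nhds_zero_of_lt_one (by norm_num) (by norm_num)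
  have hsmall : ∀ (h : E) (δ : ℝ), 0 < δ → ∀ᶠ m in atTop, ‖r m • h‖ ≤ δ := by
    intro h δ hδ
    have ht : Tendsto (fun m => ‖r m • h‖) atTop (𝓝 0) := by
      simpa using (hrt.smul_const h).norm
    exact (ht.eventually_lt_const hδ).mono fun m hm => hm.le
  -- comparison of two difference quotients along the same direction
  have hcmp : ∀ (ε δ : ℝ), IncrementsAlmostLinear g y ε δ → ∀ (h : E) (m l : ℕ), m ≤ l →
      ‖r m • h‖ ≤ δ → ‖(r l)⁻¹ • G (r l • h) - (r m)⁻¹ • G (r m • h)‖ ≤ ε * ‖h‖ := by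
    intro ε δ hA h m l hml hmδ
    have h1 := hA.1 (r m • h) hmδ (r (l - m)) ⟨(hr0 _).le, hr1 _⟩
    have hmul : r (l - m) * r m = r l := by
      simp only [hr]
      rw [← pow_add, Nat.sub_add_cancel hml]
    rw [smul_smul, hmul, norm_smul, Real.norm_of_nonneg (hr0 m).le, ← mul_assoc (r (l - m)),
      hmul] at h1
    have heq : (r l)⁻¹ • G (r l • h) - (r m)⁻¹ • G (r m • h) =
        (r l)⁻¹ • (G (r l • h) - r (l - m) • G (r m • h)) := by
      rw [smul_sub _ (G (r l • h)), smul_smul]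
      congr 2
      rw [← hmul]
      field_simp [(hr0 (l - m)).ne', (hr0 m).ne']
    rw [heq, norm_smul, norm_inv, Real.norm_of_nonneg (hr0 l).le, inv_mul_le_iff₀ (hr0 l)]
    refine h1.trans (le_of_eq ?_)
    ring
  have hcauchy : ∀ h : E, ∃ z, Tendsto (fun m => (r m)⁻¹ • G (r m • h)) atTop (𝓝 z) := by
    intro h
    refine cauchySeq_tendsto_of_complete (Metric.cauchySeq_iff'.2 fun η hη => ?_)
    have hε : 0 < η / (‖h‖ + 1) := by positivity
    obtain ⟨δ, hδ, hA⟩ := hg _ hε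
    obtain ⟨N, hN⟩ := (hsmall h δ hδ).exists
    refine ⟨N, fun l hl => ?_⟩
    rw [dist_eq_norm]
    refine (hcmp _ _ hA h N l hl hN).trans_lt ?_
    rw [div_mul_eq_mul_div, div_lt_iff₀ (by positivity)]
    nlinarith [norm_nonneg h]
  choose L hL using hcauchy
  have happrox : ∀ (ε δ : ℝ), IncrementsAlmostLinear g y ε δ → ∀ h : E, ‖h‖ ≤ δ →
      ‖G h - L h‖ ≤ ε * ‖h‖ := by
    intro ε δ hA h hh
    rw [norm_sub_rev]
    refine le_of_tendsto ((hL h).sub_const (G h)).norm (Eventually.of_forall fun l => ?_)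
    -- At `m = 0` the scale is `1`, so the quotient is `G h` itself.
    simpa [hr] using hcmp ε δ hA h 0 l (Nat.zero_le l) (by simpa [hr] using hh)
  have hadd : ∀ h k, L (h + k) = L h + L k := by
    intro h k
    have hle : ∀ ε > 0, ‖L (h + k) - L h - L k‖ ≤ ε * (‖h‖ + ‖k‖) := by
      intro ε hε
      obtain ⟨δ, hδ, hA⟩ := hg ε hε
      refine le_of_tendsto (((hL (h + k)).sub (hL h)).sub (hL k)).norm ?_
      filter_upwards [hsmall h δ hδ, hsmall k δ hδ] with m hm hm'
      have h1 := hA.2 _ _ hm hm'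
      rw [← smul_add, norm_smul, norm_smul, Real.norm_of_nonneg (hr0 m).le] at h1
      rw [← smul_sub, ← smul_sub, norm_smul, norm_inv, Real.norm_of_nonneg (hr0 m).le,
        inv_mul_le_iff₀ (hr0 m)]
      refine h1.trans (le_of_eq ?_)
      ring
    have hzero : ‖L (h + k) - L h - L k‖ ≤ 0 := by
      refine le_of_forall_pos_le_add fun η hη => ?_
      refine (hle (η / (‖h‖ + ‖k‖ + 1)) (by positivity)).trans ?_
      rw [div_mul_eq_mul_div, div_le_iff₀ (by positivity)]
      nlinarith [norm_nonneg h, norm_nonneg k]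
    have := norm_le_zero_iff.1 hzero
    rwa [sub_sub, sub_eq_zero] at this
  -- Additivity and continuity suffice: a continuous additive map is real-linear.
  let A : E →+ F := AddMonoidHom.mk' L hadd
  have hG0 : Tendsto G (𝓝 0) (𝓝 0) := by
    have h1 : Tendsto (fun h => g (y + h)) (𝓝 0) (𝓝 (g y)) := by
      refine hc.tendsto.comp ?_
      simpa using (continuous_const_add y).tendsto (0 : E)
    simpa [hG] using h1.sub_const (g y)
  have hA : Continuous A := by
    refine continuous_of_continuousAt_zero A ?_
    obtain ⟨δ, hδ, hA⟩ := hg 1 one_pos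
    have hdiff : Tendsto (fun h => G h - L h) (𝓝 0) (𝓝 0) := by
      refine squeeze_zero_norm' (a := fun h => ‖h‖) ?_ tendsto_norm_zero
      filter_upwards [Metric.closedBall_mem_nhds (0 : E) hδ] with h hh
      simpa using happrox 1 δ hA h (mem_closedBall_zero_iff.1 hh)
    have hlim : Tendsto L (𝓝 0) (𝓝 0) := by simpa using hG0.sub hdiff
    rw [ContinuousAt, map_zero]
    exact hlim
  refine ⟨A.toRealLinearMap hA, hasFDerivAt_iff_isLittleO_nhds_zero.2 ?_⟩
  refine Asymptotics.isLittleO_iff.2 fun ε hε => ?_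
  obtain ⟨δ, hδ, hεδ⟩ := hg ε hε
  filter_upwards [Metric.closedBall_mem_nhds (0 : E) hδ] with h hh
  exact happrox ε δ hεδ h (mem_closedBall_zero_iff.1 hh)

end Differentiability

/-! ### Two variables -/

section TwoVariables

variable {E F G : Type*} [NormedAddCommGroup E] [NormedSpace ℝ E] [CompleteSpace E]
  [NormedAddCommGroup F] [NormedSpace ℝ F] [CompleteSpace F]
  [NormedAddCommGroup G] [NormedSpace ℝ G]

/-- If all partial functions in the second variable are generically differentiable, then the
partial derivative in the second variable exists at generic points of the product. -/
theorem eventually_residual_differentiableAt_snd {P : Type*} [TopologicalSpace P]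
    [BaireSpace P] [CompleteSpace G] [SecondCountableTopology F]
    {f : P × F → G} (hf : Continuous f)
    (hpartial : ∀ x, GenericallyFrechetDifferentiable fun y => f (x, y)) :
    ∀ᶠ p in residual (P × F), DifferentiableAt ℝ (fun y => f (p.1, y)) p.2 := by
  -- The factors are swapped because the category lemma takes sections in the first coordinate.
  have key : ∀ m : ℕ, ∀ᶠ q in residual (F × P), ∃ k : ℕ,
      IncrementsAlmostLinear (fun y => f (q.2, y)) q.1 (1 / ((m : ℝ) + 1)) (1 / ((k : ℝ) + 1)) := by
    intro m
    have hm : (0 : ℝ) < 1 / ((m : ℝ) + 1) := Nat.one_div_pos_of_nat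
    have hclosed : ∀ k : ℕ, IsClosed {q : F × P | IncrementsAlmostLinear (fun y => f (q.2, y)) q.1
        (1 / ((m : ℝ) + 1)) (1 / ((k : ℝ) + 1))} := fun k =>
      (isClosed_setOf_incrementsAlmostLinear hf _ _).preimage continuous_swap
    have hres := eventually_residual_mem_interior hclosed fun x => by
      have hx : ∀ᶠ y in residual F, DifferentiableAt ℝ (fun y => f (x, y)) y := by
        have := hpartial x
        rw [GenericallyFrechetDifferentiable, IsMeagre] at this
        filter_upwards [this] with y hy
        simpa using hy
      filter_upwards [hx] with y hy
      obtain ⟨δ, hδ, hA⟩ := hy.exists_incrementsAlmostLinear hm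
      obtain ⟨k, hk⟩ := exists_nat_one_div_lt hδ
      exact ⟨k, hA.mono hk.le⟩
    filter_upwards [hres] with q ⟨k, hk⟩
    have hmem := interior_subset hk
    exact ⟨k, hmem⟩
  have hall : ∀ᶠ q in residual (F × P), DifferentiableAt ℝ (fun y => f (q.2, y)) q.1 := by
    filter_upwards [eventually_countable_forall.2 key] with q hq
    refine differentiableAt_of_incrementsAlmostLinear (by fun_prop) fun ε hε => ?_
    obtain ⟨m, hm⟩ := exists_nat_one_div_lt hε
    obtain ⟨k, hk⟩ := hq m
    refine ⟨_, Nat.one_div_pos_of_nat, fun h hh r hr => (hk.1 h hh r hr).trans ?_,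
      fun h k' hh hk' => (hk.2 h k' hh hk').trans ?_⟩
    · exact mul_le_mul_of_nonneg_right hm.le (mul_nonneg hr.1 (norm_nonneg _))
    · exact mul_le_mul_of_nonneg_right hm.le (by positivity)
  exact (tendsto_residual_of_isOpenMap (Homeomorph.prodComm P F).continuous
    (Homeomorph.prodComm P F).isOpenMap).eventually hall

/-- If all partial functions in the first variable are generically differentiable and the space of
their derivatives is separable, then near a generic point the increments in the first
variable are uniformly approximated by a single linear map. -/
theorem eventually_residual_uniform_increment_fst {P : Type*} [TopologicalSpace P] [BaireSpace P]
    [SecondCountableTopology E]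
    [TopologicalSpace.SeparableSpace (E →L[ℝ] G)] {f : E × P → G} (hf : Continuous f)
    (hpartial : ∀ y, GenericallyFrechetDifferentiable fun x => f (x, y)) {ε : ℝ} (hε : 0 < ε) :
    ∀ᶠ p in residual (E × P), ∃ (T : E →L[ℝ] G) (δ : ℝ), 0 < δ ∧ ∀ᶠ q in 𝓝 p,
      ∀ h : E, ‖h‖ ≤ δ → ‖f (q.1 + h, q.2) - f q - T h‖ ≤ ε * ‖h‖ := by
  -- The index pairs an operator from a dense sequence with a radius, so countably many closed sets
  -- suffice.
  let S : ℕ × ℕ → Set (E × P) := fun i => {q | ∀ h : E, ‖h‖ ≤ 1 / ((i.2 : ℝ) + 1) →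
    ‖f (q.1 + h, q.2) - f q - TopologicalSpace.denseSeq (E →L[ℝ] G) i.1 h‖ ≤ ε * ‖h‖}
  have hclosed : ∀ i, IsClosed (S i) := by
    intro i
    simp only [S, ofPred_forall]
    exact isClosed_iInter fun h => isClosed_iInter fun _ =>
      isClosed_le (by fun_prop) continuous_const
  have hres := eventually_residual_mem_interior hclosed fun y => by
    have hy : ∀ᶠ x in residual E, DifferentiableAt ℝ (fun x => f (x, y)) x := by
      have := hpartial y
      rw [GenericallyFrechetDifferentiable, IsMeagre] at this
      filter_upwards [this] with x hx
      simpa using hx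
    filter_upwards [hy] with x ⟨L, hL⟩
    obtain ⟨δ, hδ, hb⟩ := hL.exists_norm_increment_sub_le (half_pos hε)
    obtain ⟨k, hk⟩ := exists_nat_one_div_lt hδ
    obtain ⟨j, hj⟩ := (TopologicalSpace.denseRange_denseSeq (E →L[ℝ] G)).exists_dist_lt L
      (half_pos hε)
    refine ⟨(j, k), fun h hh => ?_⟩
    have h1 := hb h (hh.trans hk.le)
    have h2 : ‖(L - TopologicalSpace.denseSeq (E →L[ℝ] G) j) h‖ ≤ ε / 2 * ‖h‖ := by
      refine (ContinuousLinearMap.le_opNorm _ _).trans ?_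
      rw [dist_eq_norm] at hj
      exact mul_le_mul_of_nonneg_right hj.le (norm_nonneg _)
    have heq : f (x + h, y) - f (x, y) - TopologicalSpace.denseSeq (E →L[ℝ] G) j h =
        (f (x + h, y) - f (x, y) - L h) + (L - TopologicalSpace.denseSeq (E →L[ℝ] G) j) h := by
      rw [sub_apply]
      abel
    change ‖f (x + h, y) - f (x, y) - TopologicalSpace.denseSeq (E →L[ℝ] G) j h‖ ≤ _
    rw [heq]
    refine (norm_add_le _ _).trans ?_
    linarith
  -- Interior membership lets one operator and one radius serve all points near `p`.
  filter_upwards [hres] with p ⟨i, hi⟩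
  exact ⟨_, _, Nat.one_div_pos_of_nat, mem_interior_iff_mem_nhds.1 hi⟩

/-- A map of two variables is differentiable where both partial derivatives exist and the
increments in the first variable are locally uniformly almost linear. -/
theorem differentiableAt_prod_of_uniform_increment_fst {E F : Type*} [NormedAddCommGroup E]
    [NormedSpace ℝ E] [NormedAddCommGroup F] [NormedSpace ℝ F] {f : E × F → G} {p : E × F}
    (h₁ : DifferentiableAt ℝ (fun x => f (x, p.2)) p.1)
    (h₂ : DifferentiableAt ℝ (fun y => f (p.1, y)) p.2)
    (hunif : ∀ ε > 0, ∃ (T : E →L[ℝ] G) (δ : ℝ), 0 < δ ∧ ∀ᶠ q in 𝓝 p,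
      ∀ h : E, ‖h‖ ≤ δ → ‖f (q.1 + h, q.2) - f q - T h‖ ≤ ε * ‖h‖) :
    DifferentiableAt ℝ f p := by
  obtain ⟨x, y⟩ := p
  obtain ⟨L, hL⟩ := h₁
  obtain ⟨M, hM⟩ := h₂
  refine ⟨L.coprod M, hasFDerivAt_iff_isLittleO_nhds_zero.2 ?_⟩
  refine Asymptotics.isLittleO_iff.2 fun ε hε => ?_
  have hε4 : 0 < ε / 4 := by positivity
  obtain ⟨T, δ, hδ, hT⟩ := hunif _ hε4
  obtain ⟨δ₁, hδ₁, hL'⟩ := hL.exists_norm_increment_sub_le hε4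
  obtain ⟨δ₂, hδ₂, hM'⟩ := hM.exists_norm_increment_sub_le hε4
  have hTxy := hT.self_of_nhds
  have hshift : Tendsto (fun w : E × F => (x, y + w.2)) (𝓝 0) (𝓝 (x, y)) := by
    have : Continuous fun w : E × F => (x, y + w.2) := by fun_prop
    simpa using this.tendsto 0
  filter_upwards [hshift.eventually hT, Metric.closedBall_mem_nhds (0 : E × F) hδ,
    Metric.closedBall_mem_nhds (0 : E × F) hδ₁, Metric.closedBall_mem_nhds (0 : E × F) hδ₂]
    with w hw hw0 hw1 hw2
  rw [mem_closedBall_zero_iff] at hw0 hw1 hw2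
  obtain ⟨h, k⟩ := w
  have hh : ‖h‖ ≤ ‖(h, k)‖ := norm_fst_le (h, k)
  have hk : ‖k‖ ≤ ‖(h, k)‖ := norm_snd_le (h, k)
  have e1 := hw h (hh.trans hw0)
  have e2 := hTxy h (hh.trans hw0)
  have e3 := hL' h (hh.trans hw1)
  have e4 := hM' k (hk.trans hw2)
  dsimp only at e1 e2 e3 e4
  -- `T` cancels: it only transfers the `h`-increment from height `y + k` to height `y`. Each of the
  -- four terms costs `ε / 4`.
  have heq : f ((x, y) + (h, k)) - f (x, y) - (L.coprod M) (h, k) =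
      (f (x + h, y + k) - f (x, y + k) - T h) - (f (x + h, y) - f (x, y) - T h) +
        (f (x + h, y) - f (x, y) - L h) + (f (x, y + k) - f (x, y) - M k) := by
    rw [ContinuousLinearMap.coprod_apply, Prod.mk_add_mk]
    abel
  rw [heq]
  refine (norm_add_le _ _).trans ?_
  refine (add_le_add_left ((norm_add_le _ _).trans
    (add_le_add_left (norm_sub_le _ _) _)) _).trans ?_
  nlinarith

theorem GenericallyFrechetDifferentiable.of_prod [CompleteSpace G]
    [TopologicalSpace.SeparableSpace E] [TopologicalSpace.SeparableSpace F]
    [TopologicalSpace.SeparableSpace (E →L[ℝ] G)] {f : E × F → G} (hf : Continuous f)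
    (h₁ : ∀ y, GenericallyFrechetDifferentiable fun x => f (x, y))
    (h₂ : ∀ x, GenericallyFrechetDifferentiable fun y => f (x, y)) :
    GenericallyFrechetDifferentiable f := by
  have : SecondCountableTopology E := UniformSpace.secondCountable_of_separable E
  have : SecondCountableTopology F := UniformSpace.secondCountable_of_separable F
  have hfst : ∀ᶠ p in residual (E × F), DifferentiableAt ℝ (fun x => f (x, p.2)) p.1 :=
    (tendsto_residual_of_isOpenMap (Homeomorph.prodComm E F).continuous
      (Homeomorph.prodComm E F).isOpenMap).eventually
      (eventually_residual_differentiableAt_snd (f := fun q : F × E => f q.swap)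
        (hf.comp continuous_swap) h₁)
  have hunif : ∀ᶠ p in residual (E × F), ∀ m : ℕ, ∃ (T : E →L[ℝ] G) (δ : ℝ), 0 < δ ∧
      ∀ᶠ q in 𝓝 p, ∀ h : E, ‖h‖ ≤ δ →
        ‖f (q.1 + h, q.2) - f q - T h‖ ≤ 1 / ((m : ℝ) + 1) * ‖h‖ :=
    eventually_countable_forall.2 fun m =>
      eventually_residual_uniform_increment_fst hf h₁ Nat.one_div_pos_of_nat
  rw [GenericallyFrechetDifferentiable, IsMeagre]
  filter_upwards [hfst, eventually_residual_differentiableAt_snd hf h₂, hunif] with p hp₁ hp₂ hp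
  rw [mem_compl_iff, mem_ofPred_eq, not_not]
  refine differentiableAt_prod_of_uniform_increment_fst hp₁ hp₂ fun ε hε => ?_
  obtain ⟨m, hm⟩ := exists_nat_one_div_lt hε
  obtain ⟨T, δ, hδ, hT⟩ := hp m
  refine ⟨T, δ, hδ, hT.mono fun q hq h hh => (hq h hh).trans ?_⟩
  exact mul_le_mul_of_nonneg_right hm.le (norm_nonneg _)

end TwoVariables

/-- Generic differentiability is invariant under linear changes of variables. -/
theorem GenericallyFrechetDifferentiable.of_comp_continuousLinearEquiv {E F G : Type*}
    [NormedAddCommGroup E] [NormedSpace ℝ E] [NormedAddCommGroup F] [NormedSpace ℝ F]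
    [NormedAddCommGroup G] [NormedSpace ℝ G] (e : E ≃L[ℝ] F) {f : F → G}
    (hf : GenericallyFrechetDifferentiable (f ∘ e)) : GenericallyFrechetDifferentiable f := by
  have h := IsMeagre.preimage_of_isOpenMap e.symm.continuous e.symm.toHomeomorph.isOpenMap hf
  refine h.mono fun x hx => ?_
  rw [mem_preimage, mem_ofPred_eq, e.comp_right_differentiableAt_iff, e.apply_symm_apply]
  exact hx

/-! ### Induction on the number of variables -/

theorem mainTheorem10 {n : ℕ} {X : Fin n → Type*} {Y : Type*}
    [∀ i, NormedAddCommGroup (X i)] [∀ i, NormedSpace ℝ (X i)] [∀ i, CompleteSpace (X i)]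
    [NormedAddCommGroup Y] [NormedSpace ℝ Y] [CompleteSpace Y]
    (hX : ∀ i, TopologicalSpace.SeparableSpace (X i))
    (hL : ∀ i : Fin n, (i : ℕ) + 1 < n → TopologicalSpace.SeparableSpace (X i →L[ℝ] Y))
    (f : (∀ i, X i) → Y) (hf : Continuous f)
    (hpartial : ∀ (i : Fin n) (x : ∀ j, X j),
      GenericallyFrechetDifferentiable (fun t : X i => f (Function.update x i t))) :
    GenericallyFrechetDifferentiable f := by
  induction n with
  | zero =>
    have : {x | ¬ DifferentiableAt ℝ f x} = ∅ :=
      eq_empty_of_forall_notMem fun x hx => hx (hasFDerivAt_of_subsingleton f x).differentiableAt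
    rw [GenericallyFrechetDifferentiable, this]
    exact IsMeagre.empty
  | succ n ih =>
    -- A single variable is also the last one, so its operator space need not be separable and the
    -- two-variable result does not apply.
    obtain rfl | hn := Nat.eq_zero_or_pos n
    · refine .of_comp_continuousLinearEquiv (ContinuousLinearEquiv.piUnique (α := Fin 1) ℝ X).symm ?_
      have heq : (fun t : X 0 => f (Function.update 0 0 t)) =
          f ∘ (ContinuousLinearEquiv.piUnique (α := Fin 1) ℝ X).symm := by
        funext t
        refine congrArg f (funext fun i => ?_)
        obtain rfl : i = 0 := Subsingleton.elim (α := Fin 1) i 0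
        rw [Function.update_self]
        rfl
      exact heq ▸ hpartial 0 0
    · have := hX 0
      have := hL 0 (by simpa using hn)
      refine .of_comp_continuousLinearEquiv (Fin.consEquivL ℝ X) (.of_prod (by fun_prop) ?_ ?_)
      · intro y
        convert hpartial 0 (Fin.cons 0 y) using 1
        ext t
        rw [Fin.update_cons_zero]
        rfl
      · intro x
        refine ih (fun i => hX i.succ) (fun i hi => hL i.succ (by simpa using hi)) _
          (hf.comp (by fun_prop)) fun i y => ?_
        convert hpartial i.succ (Fin.cons x y) using 1
        ext t
        rw [← Fin.cons_update]
        rfl
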